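/- Let $P$ be a non-empty countable set of atoms and $A$ a non-empty finite set of agents. Formulas and action formulae of arbitrary action formula logic are given by $$\varphi ::= p \mid \neg\varphi \mid (\varphi\wedge\varphi) \mid \Box_a\varphi \mid [\alpha]\varphi \mid \forall_R\varphi,\qquad \alpha ::= {?\varphi} \mid \alpha\sqcup\alpha \mid \alpha;\alpha \mid L_B(\alpha,\alpha)\quad(p\in P,\ a\in A,\ \emptyset\ne B\subseteq A),$$ where $\forall_R$ is the refinement quantifier. Put $\Diamond_a\varphi=\neg\Box_a\neg\varphi$, $\langle\alpha\rangle\varphi=\neg[\alpha]\neg\varphi$, $\exists_R\varphi=\neg\forall_R\neg\varphi$ and $\nabla_a\Gamma=\Box_a\bigvee_{\gamma\in\Gamma}\gamma\wedge\bigwedge_{\gamma\in\Gamma}\Diamond_a\gamma$ for finite $\Gamma$. A formula is modal if it contains neither $[\alpha]$ nor $\forall_R$, propositional if it moreover contains no $\Box_a$; for $C\subseteq A$, a modal formula is $C$-restricted if all its outermost boxes belong to agents in $C$. The formulas in $a$-alternating disjunctive normal form ($a$-ADNF) are those generated by $\varphi::=\pi\wedge\bigwedge_{b\in B}\nabla_b\Gamma_b\mid\varphi\vee\varphi$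 with $\pi$ propositional, $B\subseteq A\setminus\{a\}$ and each $\Gamma_b$ a finite set of formulas in $b$-ADNF. Let $\vdash$ be derivability in the following axiomatisation for K45 (transitive, Euclidean frames), whose schemas range over the whole language: propositional tautologies, modus ponens, and, for each $a$, $\Box_a(\varphi\to\psi)\to(\Box_a\varphi\to\Box_a\psi)$, $\Box_a\varphi\to\Box_a\Box_a\varphi$, $\Diamond_a\varphi\to\Box_a\Diamond_a\varphi$ and necessitation for $\Box_a$; the axioms - $[\alpha](\varphi\to\psi)\to([\alpha]\varphi\to[\alpha]\psi)$, and the rule: from $\vdash\varphi$ infer $\vdash[\alpha]\varphi$; - (LT) $[?\varphi]\psi\leftrightarrow(\varphi\to\psi)$ for modal $\psi$; - (LU) $[\alpha\sqcup\beta]\varphi\leftrightarrow[\alpha]\varphi\wedge[\beta]\varphi$; (LS) $[\alpha;\beta]\varphi\leftrightarrow[\alpha][\beta]\varphi$; - with $L=L_B(\alpha,\beta)$: (LP) $[L]p\leftrightarrow p$; (LN) $[L]\neg\varphi\leftrightarrow\neg[L]\varphi$; (LC) $[L](\varphi\wedge\psi)\leftrightarrow[L]\varphi\wedge[L]\psi$;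 (LK1) $[L]\Box_a\chi\leftrightarrow\Box_a[\alpha\sqcup\beta]\chi$ for $a\in B$ and $\chi$ $(A\setminus\{a\})$-restricted; (LK2) $[L]\Box_a\varphi\leftrightarrow\Box_a\varphi$ for $a\notin B$; - (R) $\forall_R(\varphi\to\psi)\to(\forall_R\varphi\to\forall_R\psi)$; (RP) $\forall_R\pi\leftrightarrow\pi$ for propositional $\pi$; and the rule: from $\vdash\varphi$ infer $\vdash\forall_R\varphi$; - (RK45) $\exists_R\nabla_a\Gamma\leftrightarrow\bigwedge_{\gamma\in\Gamma}\Diamond_a\exists_R\gamma$, for $\Gamma$ a finite set of $a$-ADNF formulas; - (RDist) $\exists_R\bigwedge_{a\in A}\nabla_a\Gamma_a\leftrightarrow\bigwedge_{a\in A}\exists_R\nabla_a\Gamma_a$, for each $\Gamma_a$ a finite set of $a$-ADNF formulas. **Proposition.** For every formula $\varphi$ in which $\forall_R$ does not occur (not even inside tests), there is an action formula $\alpha$ in which $\forall_R$ does not occur such that $\vdash[\alpha]\varphi$ and $\vdash\exists_R\varphi\to\langle\alpha\rangle\varphi$. -/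

import Mathlib

universe u v

namespace ActionFormulaLogic

/- The language of arbitrary action formula logic, over propositional atoms `P` and agents `A`,
   together with the language of action formulae. -/
mutual
  /-- Formulas `p`, `¬ φ`, `φ ∧ ψ`, `□ a φ`, `[α] φ`, and `∀R φ`, where `allRefs` is the
  refinement quantifier (true in every refinement). -/
  inductive Form (P : Type u) (A : Type v) : Type (max u v)
    | atom (p : P) : Form P A
    | neg (φ : Form P A) : Form P A
    | and (φ ψ : Form P A) : Form P A
    | box (a : A) (φ : Form P A) : Form P A
    | allActs (α : Act P A) (φ : Form P A) : Form P A
    | allRefs (φ : Form P A) : Form P A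

  /-- Action formulae: tests, non-deterministic choice, sequential execution, and learning by
  a non-empty set `B` of agents. -/
  inductive Act (P : Type u) (A : Type v) : Type (max u v)
    | test (φ : Form P A) : Act P A
    | choice (α β : Act P A) : Act P A
    | seq (α β : Act P A) : Act P A
    | learn (B : Finset A) (hB : B.Nonempty) (α β : Act P A) : Act P A
end

variable {P : Type u} {A : Type v}

namespace Form

/-! Standard abbreviations. -/

def or (φ ψ : Form P A) : Form P A := neg (and (neg φ) (neg ψ))

def imp (φ ψ : Form P A) : Form P A := neg (and φ (neg ψ))

def iff (φ ψ : Form P A) : Form P A := and (imp φ ψ) (imp ψ φ)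

def diamond (a : A) (φ : Form P A) : Form P A := neg (box a (neg φ))

def someActs (α : Act P A) (φ : Form P A) : Form P A := neg (allActs α (neg φ))

def someRefs (φ : Form P A) : Form P A := neg (allRefs (neg φ))

noncomputable def bot [Nonempty P] : Form P A :=
  and (atom (Classical.arbitrary P)) (neg (atom (Classical.arbitrary P)))

noncomputable def top [Nonempty P] : Form P A := neg bot

/-- Conjunction over a finite family (finite sets of formulas are presented by lists). -/
noncomputable def bigAnd [Nonempty P] : List (Form P A) → Form P A
  | [] => top
  | φ :: l => and φ (bigAnd l)

noncomputable def bigOr [Nonempty P] : List (Form P A) → Form P A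
  | [] => bot
  | φ :: l => or φ (bigOr l)

/-- The cover operator. -/
noncomputable def cover [Nonempty P] (a : A) (Γ : List (Form P A)) : Form P A :=
  and (box a (bigOr Γ)) (bigAnd (Γ.map (diamond a)))

/-- Propositional formulas. -/
def IsProp : Form P A → Prop
  | atom _ => True
  | neg φ => φ.IsProp
  | and φ ψ => φ.IsProp ∧ ψ.IsProp
  | box _ _ => False
  | allActs _ _ => False
  | allRefs _ => False

/-- Formulas of basic modal logic. -/
def IsModal : Form P A → Prop
  | atom _ => True
  | neg φ => φ.IsModal
  | and φ ψ => φ.IsModal ∧ ψ.IsModal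
  | box _ φ => φ.IsModal
  | allActs _ _ => False
  | allRefs _ => False

/-- `B`-restricted formulas: modal formulas whose outermost boxes all belong to agents in `B`
(inside these boxes any modal formula is allowed). -/
def IsRestricted (B : Set A) : Form P A → Prop
  | atom _ => True
  | neg φ => φ.IsRestricted B
  | and φ ψ => φ.IsRestricted B ∧ ψ.IsRestricted B
  | box b φ => b ∈ B ∧ φ.IsModal
  | allActs _ _ => False
  | allRefs _ => False

/-- Truth-functional evaluation, where `v` assigns a truth value to every formula that is neither
a negation nor a conjunction. -/
def boolEval (v : Form P A → Prop) : Form P A → Prop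
  | neg φ => ¬ φ.boolEval v
  | and φ ψ => φ.boolEval v ∧ ψ.boolEval v
  | atom p => v (atom p)
  | box a φ => v (box a φ)
  | allActs α φ => v (allActs α φ)
  | allRefs φ => v (allRefs φ)

/-- Substitution instances of propositional tautologies. -/
def IsTautology (φ : Form P A) : Prop := ∀ v : Form P A → Prop, φ.boolEval v

/-- `a`-alternating disjunctive normal form. -/
inductive IsADNF [Nonempty P] : A → Form P A → Prop
  | conj (a : A) (π : Form P A) (hπ : π.IsProp) (B : Finset A) (haB : a ∉ B)
      (Γ : A → List (Form P A)) (hΓ : ∀ b ∈ B, ∀ γ ∈ Γ b, IsADNF b γ) :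
      IsADNF a (and π (bigAnd (B.toList.map fun b => cover b (Γ b))))
  | disj (a : A) (φ ψ : Form P A) (hφ : IsADNF a φ) (hψ : IsADNF a ψ) : IsADNF a (or φ ψ)

end Form

/- The sublanguage of action formula logic: no refinement quantifier occurs, neither in the
   formula nor inside the tests of its action formulae. -/
mutual
  def Form.IsAFL : Form P A → Prop
    | .atom _ => True
    | .neg φ => φ.IsAFL
    | .and φ ψ => φ.IsAFL ∧ ψ.IsAFL
    | .box _ φ => φ.IsAFL
    | .allActs α φ => α.IsAFL ∧ φ.IsAFL
    | .allRefs _ => False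

  def Act.IsAFL : Act P A → Prop
    | .test φ => φ.IsAFL
    | .choice α β => α.IsAFL ∧ β.IsAFL
    | .seq α β => α.IsAFL ∧ β.IsAFL
    | .learn _ _ α β => α.IsAFL ∧ β.IsAFL
end

open Form in
/-- Theorems of the axiomatisation of arbitrary action formula logic over the class of models
with transitive and Euclidean accessibility relations. -/
inductive Provable [Nonempty P] [Fintype A] : Form P A → Prop
  -- the modal logic K45
  | taut (φ : Form P A) (h : φ.IsTautology) : Provable φ
  | mp (φ ψ : Form P A) (h₁ : Provable (imp φ ψ)) (h₂ : Provable φ) : Provable ψ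
  | axK (a : A) (φ ψ : Form P A) :
      Provable (imp (box a (imp φ ψ)) (imp (box a φ) (box a ψ)))
  | ax4 (a : A) (φ : Form P A) : Provable (imp (box a φ) (box a (box a φ)))
  | ax5 (a : A) (φ : Form P A) : Provable (imp (diamond a φ) (box a (diamond a φ)))
  | necK (a : A) (φ : Form P A) (h : Provable φ) : Provable (box a φ)
  -- action formulae
  | distL (α : Act P A) (φ ψ : Form P A) :
      Provable (imp (allActs α (imp φ ψ)) (imp (allActs α φ) (allActs α ψ)))
  | necL (α : Act P A) (φ : Form P A) (h : Provable φ) : Provable (allActs α φ)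
  | LT (φ ψ : Form P A) (hψ : ψ.IsModal) :
      Provable (iff (allActs (.test φ) ψ) (imp φ ψ))
  | LU (α β : Act P A) (φ : Form P A) :
      Provable (iff (allActs (.choice α β) φ) (and (allActs α φ) (allActs β φ)))
  | LS (α β : Act P A) (φ : Form P A) :
      Provable (iff (allActs (.seq α β) φ) (allActs α (allActs β φ)))
  | LP (B : Finset A) (hB : B.Nonempty) (α β : Act P A) (p : P) :
      Provable (iff (allActs (.learn B hB α β) (atom p)) (atom p))
  | LN (B : Finset A) (hB : B.Nonempty) (α β : Act P A) (φ : Form P A) :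
      Provable (iff (allActs (.learn B hB α β) (neg φ)) (neg (allActs (.learn B hB α β) φ)))
  | LC (B : Finset A) (hB : B.Nonempty) (α β : Act P A) (φ ψ : Form P A) :
      Provable (iff (allActs (.learn B hB α β) (and φ ψ))
        (and (allActs (.learn B hB α β) φ) (allActs (.learn B hB α β) ψ)))
  | LK1 (B : Finset A) (hB : B.Nonempty) (α β : Act P A) (a : A) (ha : a ∈ B)
      (χ : Form P A) (hχ : χ.IsRestricted {b | b ≠ a}) :
      Provable (iff (allActs (.learn B hB α β) (box a χ))
        (box a (allActs (.choice α β) χ)))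
  | LK2 (B : Finset A) (hB : B.Nonempty) (α β : Act P A) (a : A) (ha : a ∉ B)
      (φ : Form P A) :
      Provable (iff (allActs (.learn B hB α β) (box a φ)) (box a φ))
  -- refinement quantifiers
  | R (φ ψ : Form P A) :
      Provable (imp (allRefs (imp φ ψ)) (imp (allRefs φ) (allRefs ψ)))
  | RP (π : Form P A) (hπ : π.IsProp) : Provable (iff (allRefs π) π)
  | RK45 (a : A) (Γ : List (Form P A)) (hΓ : ∀ γ ∈ Γ, IsADNF a γ) :
      Provable (iff (someRefs (cover a Γ))
        (bigAnd (Γ.map fun γ => diamond a (someRefs γ))))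
  | RDist (Γ : A → List (Form P A)) (hΓ : ∀ a, ∀ γ ∈ Γ a, IsADNF a γ) :
      Provable (iff
        (someRefs (bigAnd ((Finset.univ : Finset A).toList.map fun a => cover a (Γ a))))
        (bigAnd ((Finset.univ : Finset A).toList.map fun a => someRefs (cover a (Γ a)))))
  | necR (φ : Form P A) (h : Provable φ) : Provable (allRefs φ)

end ActionFormulaLogic

-- Derivability is membership in every world of a canonical model. Since `box a`, `[α]` and `∀R` are
-- all normal, each is universal quantification over a canonical relation, and no Kripke semantics
-- for actions or refinements is needed.
--
-- Every formula without `∀R` is equivalent to a modal one (`reducible_of_isAFL`), and every modal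
-- one to a disjunction of terms `π ∧ ⋀ ∇_b Γ_b` with each member of `Γ_b` in `b`-ADNF
-- (`exists_normal_form`). Normal forms come from counting types: up to bounded bisimilarity over
-- finitely many atoms there are finitely many worlds, each described by a term. In K45 a second
-- consecutive step of the same agent reaches nothing new, so bisimulations, and hence terms, may
-- alternate agents.
--
-- Actions are then built by recursion on the normal form. A disjunction is realised by choice. For
-- a term, let `β_b` be the choice of the actions for the members of `Γ_b`. Test `e = π ∧ ⋀ ◇_b
-- ⟨β_b⟩ γ`, then let each `b` in turn learn `β_b` (`synthesizable_term`). After learning, `□_b χ`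
-- means `□_b [β_b] χ`, so `e` together with `⊢ [β_b] ⋁ Γ_b` makes the term true. Conversely, if
-- some refinement satisfies the term, then RP gives `π` and RK45 gives `◇_b ∃R γ`, hence `◇_b ⟨β_b⟩
-- γ` by recursion, so the test succeeds.

namespace ActionFormulaLogic

universe u' v'

variable {P : Type u'} {A : Type v'} [Nonempty P] [Fintype A]

open Form

set_option linter.unusedSectionVars false

-- Canonical worlds and Lindenbaum's lemma.

/-- A world of the canonical model: a Boolean-consistent and complete set of formulas that
contains all theorems. -/
structure World (P : Type u') (A : Type v') [Nonempty P] [Fintype A] where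
  carrier : Set (Form P A)
  neg_mem' : ∀ φ, neg φ ∈ carrier ↔ φ ∉ carrier
  and_mem' : ∀ φ ψ, Form.and φ ψ ∈ carrier ↔ φ ∈ carrier ∧ ψ ∈ carrier
  provable_mem' : ∀ φ, Provable φ → φ ∈ carrier

instance : Membership (Form P A) (World P A) := ⟨fun w φ => φ ∈ w.carrier⟩

namespace World

variable {w : World P A} {φ ψ : Form P A}

theorem provable_mem (w : World P A) (h : Provable φ) : φ ∈ w := w.provable_mem' φ h

@[simp] theorem mem_neg : neg φ ∈ w ↔ φ ∉ w := w.neg_mem' φ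

@[simp] theorem mem_and : Form.and φ ψ ∈ w ↔ φ ∈ w ∧ ψ ∈ w := w.and_mem' φ ψ

@[simp] theorem mem_or : or φ ψ ∈ w ↔ φ ∈ w ∨ ψ ∈ w := by
  simp only [Form.or, mem_neg, mem_and]; tauto

@[simp] theorem mem_imp : imp φ ψ ∈ w ↔ (φ ∈ w → ψ ∈ w) := by
  simp only [Form.imp, mem_neg, mem_and]; tauto

@[simp] theorem mem_iff : iff φ ψ ∈ w ↔ (φ ∈ w ↔ ψ ∈ w) := by
  simp only [Form.iff, mem_imp, mem_and]; tauto

@[simp] theorem not_mem_bot : bot ∉ w := by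
  simp only [Form.bot, mem_neg, mem_and]; tauto

@[simp] theorem mem_top : top ∈ w := by simp [Form.top]

@[simp] theorem mem_bigAnd {l : List (Form P A)} : bigAnd l ∈ w ↔ ∀ φ ∈ l, φ ∈ w := by
  induction l with
  | nil => simp [bigAnd]
  | cons a l ih => simp [bigAnd, ih]

@[simp] theorem mem_bigOr {l : List (Form P A)} : bigOr l ∈ w ↔ ∃ φ ∈ l, φ ∈ w := by
  induction l with
  | nil => simp [bigOr]
  | cons a l ih => simp [bigOr, ih]

end World

/-- If a set of formulas contains the tautologies and is closed under modus ponens, then so is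
everything that follows from finitely many members of it by propositional logic. -/
theorem mem_of_taut_consequence {T : Set (Form P A)} (htaut : ∀ φ, φ.IsTautology → φ ∈ T)
    (hmp : ∀ φ ψ, imp φ ψ ∈ T → φ ∈ T → ψ ∈ T) (l : List (Form P A)) :
    ∀ φ : Form P A, (∀ ψ ∈ l, ψ ∈ T) →
      (∀ v, (∀ ψ ∈ l, boolEval v ψ) → boolEval v φ) → φ ∈ T := by
  induction l with
  | nil => exact fun φ _ h => htaut φ fun v => h v (by simp)
  | cons a l ih =>
    intro φ hl h
    refine hmp a φ (ih _ (fun ψ hψ => hl ψ (by simp [hψ])) fun v hv => ?_) (hl a (by simp))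
    simp only [imp, boolEval]
    rintro ⟨ha, hn⟩
    exact hn (h v (by simpa using ⟨ha, hv⟩))

/-- Lindenbaum's lemma. -/
theorem exists_world {T : Set (Form P A)} (hprov : ∀ φ, Provable φ → φ ∈ T)
    (hmp : ∀ φ ψ, imp φ ψ ∈ T → φ ∈ T → ψ ∈ T) {φ : Form P A} (hφ : φ ∉ T) :
    ∃ w : World P A, (∀ ψ ∈ T, ψ ∈ w) ∧ φ ∉ w := by
  classical
  -- Otherwise `φ` would follow propositionally from finitely many members of `T`, hence lie in `T`.
  have key : ∀ S : Finset T, ∃ v : Form P A → Prop,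
      (∀ ψ ∈ S, boolEval v ψ.1) ∧ ¬ boolEval v φ := by
    intro S
    by_contra hcon
    push Not at hcon
    refine hφ (mem_of_taut_consequence (fun φ h => hprov φ (.taut φ h)) hmp
      (S.toList.map Subtype.val) φ (by simp +contextual) fun v hv => hcon v fun ψ hψ => ?_)
    exact hv ψ.1 (List.mem_map.2 ⟨ψ, by simpa using hψ, rfl⟩)
  choose v hvS hvφ using key
  -- The world is the limit of these valuations along an ultrafilter finer than `atTop`: each `ψ` in
  -- `T` holds from `{ψ}` onwards, `φ` never does, and ultrafilters commute with negation and
  -- conjunction.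
  let U : Ultrafilter (Finset T) := Ultrafilter.of Filter.atTop
  have hT : ∀ ψ ∈ T, ∀ᶠ S in (U : Filter (Finset T)), boolEval (v S) ψ := by
    intro ψ hψ
    refine Filter.Eventually.filter_mono (Ultrafilter.of_le _) ?_
    filter_upwards [Filter.eventually_ge_atTop {(⟨ψ, hψ⟩ : T)}] with S hS
    exact hvS S ⟨ψ, hψ⟩ (hS (by simp))
  refine ⟨⟨{ψ | ∀ᶠ S in (U : Filter (Finset T)), boolEval (v S) ψ}, fun φ => ?_, fun φ ψ => ?_,
    fun ψ hψ => hT ψ (hprov ψ hψ)⟩, hT, fun h => ?_⟩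
  · simp only [Set.mem_ofPred_eq, boolEval]
    exact Ultrafilter.eventually_not
  · simp only [Set.mem_ofPred_eq, boolEval]
    exact Filter.eventually_and
  · obtain ⟨S, hS⟩ := Filter.Eventually.exists (f := (U : Filter (Finset T))) h
    exact hvφ S hS

theorem provable_iff {φ : Form P A} : Provable φ ↔ ∀ w : World P A, φ ∈ w := by
  refine ⟨fun h w => w.provable_mem h, fun h => ?_⟩
  by_contra hn
  obtain ⟨w, -, hw⟩ := exists_world (T := {φ : Form P A | Provable φ}) (fun _ h => h)
    (fun φ ψ h₁ h₂ => .mp φ ψ h₁ h₂) hn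
  exact hw (h w)

-- Canonical relations of the normal operators.

/-- The canonical accessibility relation of an operator on formulas. -/
def Rel (f : Form P A → Form P A) (w v : World P A) : Prop := ∀ φ, f φ ∈ w → φ ∈ v

/-- Distribution and necessitation make `{φ | f φ ∈ w}` contain the theorems and be closed under
modus ponens, so Lindenbaum's lemma separates any missing formula from it. -/
theorem mem_normal {f : Form P A → Form P A}
    (hK : ∀ φ ψ, Provable (imp (f (imp φ ψ)) (imp (f φ) (f ψ))))
    (hN : ∀ φ, Provable φ → Provable (f φ)) {w : World P A} {φ : Form P A} :
    f φ ∈ w ↔ ∀ v, Rel f w v → φ ∈ v := by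
  refine ⟨fun h v hv => hv φ h, fun h => ?_⟩
  by_contra hn
  obtain ⟨v, hv, hφ⟩ := exists_world (T := {φ | f φ ∈ w})
    (fun φ h => w.provable_mem (hN φ h))
    (fun φ ψ h₁ h₂ => by
      have := w.provable_mem (hK φ ψ)
      simp only [World.mem_imp] at this
      exact this h₁ h₂) hn
  exact hφ (h v hv)

namespace World

variable {w : World P A} {φ ψ : Form P A}

/-- Accessibility for an agent. -/
abbrev Acc (a : A) : World P A → World P A → Prop := Rel (box a)

@[simp] theorem mem_box {a : A} : box a φ ∈ w ↔ ∀ v, Acc a w v → φ ∈ v :=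
  mem_normal (Provable.axK a) (Provable.necK a)

@[simp] theorem mem_diamond {a : A} : diamond a φ ∈ w ↔ ∃ v, Acc a w v ∧ φ ∈ v := by
  simp [diamond]

@[simp] theorem mem_allActs {α : Act P A} :
    allActs α φ ∈ w ↔ ∀ v, Rel (allActs α) w v → φ ∈ v :=
  mem_normal (Provable.distL α) (Provable.necL α)

@[simp] theorem mem_allRefs : allRefs φ ∈ w ↔ ∀ v, Rel allRefs w v → φ ∈ v :=
  mem_normal Provable.R Provable.necR

@[simp] theorem mem_someRefs : someRefs φ ∈ w ↔ ∃ v, Rel allRefs w v ∧ φ ∈ v := by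
  simp [someRefs]

@[simp] theorem mem_cover {a : A} {Γ : List (Form P A)} : cover a Γ ∈ w ↔
    (∀ v, Acc a w v → ∃ γ ∈ Γ, γ ∈ v) ∧ ∀ γ ∈ Γ, ∃ v, Acc a w v ∧ γ ∈ v := by
  simp [cover]

theorem Acc.trans {a : A} {u v w : World P A} (h : Acc a u v) (h' : Acc a v w) : Acc a u w :=
  fun φ hφ => h' φ (h _ (mem_imp.1 (u.provable_mem (.ax4 a φ)) hφ))

theorem Acc.eucl {a : A} {u v w : World P A} (h : Acc a u v) (h' : Acc a u w) : Acc a v w := by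
  intro φ hφ
  by_contra hn
  have h5 := mem_imp.1 (u.provable_mem (.ax5 a (neg φ))) (mem_diamond.2 ⟨w, h', mem_neg.2 hn⟩)
  obtain ⟨x, hx, hx'⟩ := mem_diamond.1 (h _ h5)
  exact mem_neg.1 hx' (hx φ hφ)

end World

open World

/-! Provable equivalence, expressed in the canonical model. -/

def Equi (φ ψ : Form P A) : Prop := ∀ w : World P A, φ ∈ w ↔ ψ ∈ w

theorem Equi.of_provable {φ ψ : Form P A} (h : Provable (iff φ ψ)) : Equi φ ψ :=
  fun w => mem_iff.1 (w.provable_mem h)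

theorem Equi.trans {φ ψ χ : Form P A} (h : Equi φ ψ) (h' : Equi ψ χ) : Equi φ χ :=
  fun w => (h w).trans (h' w)

theorem Equi.neg {φ ψ : Form P A} (h : Equi φ ψ) : Equi (neg φ) (neg ψ) :=
  fun w => by simp [h w]

theorem Equi.and {φ ψ φ' ψ' : Form P A} (h : Equi φ ψ) (h' : Equi φ' ψ') :
    Equi (Form.and φ φ') (Form.and ψ ψ') :=
  fun w => by simp [h w, h' w]

theorem Equi.box {φ ψ : Form P A} (a : A) (h : Equi φ ψ) : Equi (box a φ) (box a ψ) :=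
  fun w => by simp only [mem_box, h _]

theorem Equi.allActs {φ ψ : Form P A} (α : Act P A) (h : Equi φ ψ) :
    Equi (allActs α φ) (allActs α ψ) :=
  fun w => by simp only [mem_allActs, h _]

/-! Syntactic classes. -/

theorem isProp_bot : (bot : Form P A).IsProp := by simp [bot, IsProp]

theorem isModal_of_isProp : ∀ {φ : Form P A}, φ.IsProp → φ.IsModal
  | .atom _, _ => trivial
  | .neg φ, h => isModal_of_isProp (φ := φ) h
  | .and _ _, h => ⟨isModal_of_isProp h.1, isModal_of_isProp h.2⟩

theorem isRestricted_of_isProp {C : Set A} : ∀ {φ : Form P A}, φ.IsProp → φ.IsRestricted C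
  | .atom _, _ => trivial
  | .neg φ, h => isRestricted_of_isProp (φ := φ) h
  | .and _ _, h => ⟨isRestricted_of_isProp h.1, isRestricted_of_isProp h.2⟩

theorem isModal_of_isRestricted {C : Set A} : ∀ {φ : Form P A}, φ.IsRestricted C → φ.IsModal
  | .atom _, _ => trivial
  | .neg φ, h => isModal_of_isRestricted (φ := φ) h
  | .and _ _, h => ⟨isModal_of_isRestricted h.1, isModal_of_isRestricted h.2⟩
  | .box _ _, h => h.2

theorem isAFL_of_isModal : ∀ {φ : Form P A}, φ.IsModal → φ.IsAFL
  | .atom _, _ => by simp [Form.IsAFL]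
  | .neg φ, h => by
    simp only [Form.IsAFL]; exact isAFL_of_isModal (φ := φ) h
  | .and _ _, h => by
    simp only [Form.IsAFL]; exact ⟨isAFL_of_isModal h.1, isAFL_of_isModal h.2⟩
  | .box _ φ, h => by
    simp only [Form.IsAFL]; exact isAFL_of_isModal (φ := φ) h

/-- Formulas in which every outermost box of an agent is applied to a formula whose outermost
boxes belong to other agents. -/
def AltOuter : Form P A → Prop
  | atom _ => True
  | neg φ => AltOuter φ
  | .and φ ψ => AltOuter φ ∧ AltOuter ψ
  | box a φ => φ.IsRestricted {b | b ≠ a}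
  | allActs _ _ => False
  | allRefs _ => False

theorem altOuter_of_isProp : ∀ {φ : Form P A}, φ.IsProp → AltOuter φ
  | .atom _, _ => trivial
  | .neg φ, h => altOuter_of_isProp (φ := φ) h
  | .and _ _, h => ⟨altOuter_of_isProp h.1, altOuter_of_isProp h.2⟩

section Closure

variable {p : Form P A → Prop}

theorem closed_bigAnd (hneg : ∀ φ, p φ → p (neg φ)) (hand : ∀ φ ψ, p φ → p ψ → p (Form.and φ ψ))
    (hbot : p bot) {l : List (Form P A)} (h : ∀ φ ∈ l, p φ) : p (bigAnd l) := by
  induction l with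
  | nil => exact hneg _ hbot
  | cons a l ih =>
    exact hand _ _ (h a (by simp)) (ih fun φ hφ => h φ (by simp [hφ]))

theorem closed_bigOr (hneg : ∀ φ, p φ → p (neg φ)) (hand : ∀ φ ψ, p φ → p ψ → p (Form.and φ ψ))
    (hbot : p bot) {l : List (Form P A)} (h : ∀ φ ∈ l, p φ) : p (bigOr l) := by
  induction l with
  | nil => exact hbot
  | cons a l ih =>
    exact hneg _ (hand _ _ (hneg _ (h a (by simp))) (hneg _ (ih fun φ hφ => h φ (by simp [hφ]))))

theorem closed_cover (hneg : ∀ φ, p φ → p (neg φ)) (hand : ∀ φ ψ, p φ → p ψ → p (Form.and φ ψ))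
    (hbot : p bot) {a : A} {Γ : List (Form P A)} (hor : p (box a (bigOr Γ)))
    (h : ∀ φ ∈ Γ, p (box a (neg φ))) : p (cover a Γ) :=
  hand _ _ hor (closed_bigAnd hneg hand hbot (by simpa [diamond] using fun φ hφ => hneg _ (h φ hφ)))

end Closure

theorem isModal_bigOr {l : List (Form P A)} (h : ∀ φ ∈ l, φ.IsModal) : (bigOr l).IsModal :=
  closed_bigOr (p := IsModal) (fun _ h => h) (fun _ _ h h' => ⟨h, h'⟩)
    (isModal_of_isProp isProp_bot) h

theorem isRestricted_bigOr {C : Set A} {l : List (Form P A)} (h : ∀ φ ∈ l, φ.IsRestricted C) :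
    (bigOr l).IsRestricted C :=
  closed_bigOr (p := IsRestricted C) (fun _ h => h) (fun _ _ h h' => ⟨h, h'⟩)
    (isRestricted_of_isProp isProp_bot) h

theorem altOuter_bigOr {l : List (Form P A)} (h : ∀ φ ∈ l, AltOuter φ) : AltOuter (bigOr l) :=
  closed_bigOr (p := AltOuter) (fun _ h => h) (fun _ _ h h' => ⟨h, h'⟩)
    (altOuter_of_isProp isProp_bot) h

/-- The outermost boxes come from covers by agents in `B`, and `a ∉ B`. This provides the side
condition of LK1. -/
theorem Form.IsADNF.isRestricted {a : A} {φ : Form P A} (h : IsADNF a φ) :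
    φ.IsRestricted {b | b ≠ a} := by
  induction h with
  | conj a π hπ B haB Γ _ ih =>
    refine ⟨isRestricted_of_isProp hπ, closed_bigAnd (p := IsRestricted {b | b ≠ a})
      (fun _ h => h) (fun _ _ h h' => ⟨h, h'⟩) (isRestricted_of_isProp isProp_bot) ?_⟩
    simp only [List.mem_map, Finset.mem_toList, forall_exists_index, and_imp,
      forall_apply_eq_imp_iff₂]
    intro b hb
    have hba : b ∈ {b | b ≠ a} := fun h => haB (h ▸ hb)
    have hm : ∀ γ ∈ Γ b, γ.IsModal := fun γ hγ => isModal_of_isRestricted (ih b hb γ hγ)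
    exact closed_cover (p := IsRestricted {b | b ≠ a})
      (fun _ h => h) (fun _ _ h h' => ⟨h, h'⟩) (isRestricted_of_isProp isProp_bot)
      ⟨hba, isModal_bigOr hm⟩ fun φ hφ => ⟨hba, hm φ hφ⟩
  | disj a φ ψ _ _ h₁ h₂ => exact ⟨h₁, h₂⟩

/-- Conjunctions of a propositional formula and covers, by agents in `C`, of formulas in
alternating disjunctive normal form. -/
def IsTerm (C : Finset A) (φ : Form P A) : Prop :=
  ∃ π : Form P A, π.IsProp ∧ ∃ B ⊆ C, ∃ Γ : A → List (Form P A),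
    (∀ b ∈ B, ∀ γ ∈ Γ b, IsADNF b γ) ∧ φ = Form.and π (bigAnd (B.toList.map fun b => cover b (Γ b)))

theorem IsTerm.isADNF {C : Finset A} {a : A} {φ : Form P A} (h : IsTerm C φ) (ha : a ∉ C) :
    IsADNF a φ := by
  obtain ⟨π, hπ, B, hB, Γ, hΓ, rfl⟩ := h
  exact .conj a π hπ B (fun h => ha (hB h)) Γ hΓ

theorem IsTerm.altOuter {C : Finset A} {φ : Form P A} (h : IsTerm C φ) : AltOuter φ := by
  obtain ⟨π, hπ, B, hB, Γ, hΓ, rfl⟩ := h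
  refine ⟨altOuter_of_isProp hπ, closed_bigAnd (p := AltOuter)
    (fun _ h => h) (fun _ _ h h' => ⟨h, h'⟩) (altOuter_of_isProp isProp_bot) ?_⟩
  simp only [List.mem_map, Finset.mem_toList, forall_exists_index, and_imp,
    forall_apply_eq_imp_iff₂]
  intro b hb
  have hr : ∀ γ ∈ Γ b, γ.IsRestricted {c | c ≠ b} := fun γ hγ => (hΓ b hb γ hγ).isRestricted
  exact closed_cover (p := AltOuter)
    (fun _ h => h) (fun _ _ h h' => ⟨h, h'⟩) (altOuter_of_isProp isProp_bot)
    (isRestricted_bigOr hr) fun φ hφ => hr φ hφ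

theorem AltOuter.isModal : ∀ {φ : Form P A}, AltOuter φ → φ.IsModal
  | .atom _, _ => trivial
  | .neg φ, h => AltOuter.isModal (φ := φ) h
  | .and _ _, h => ⟨AltOuter.isModal h.1, AltOuter.isModal h.2⟩
  | .box _ φ, h => isModal_of_isRestricted (φ := φ) h

/-! Bounded bisimilarity and disjunctive normal forms. -/

/-- Bisimilarity to a bounded depth, over finitely many atoms; the first step uses only the
agents in `C`, and no agent makes two consecutive steps. -/
def Sim (Q : List P) : ℕ → Set A → World P A → World P A → Prop
  | 0, _, w, w' => ∀ p ∈ Q, atom p ∈ w ↔ atom p ∈ w'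
  | n + 1, C, w, w' => (∀ p ∈ Q, atom p ∈ w ↔ atom p ∈ w') ∧ ∀ b ∈ C,
      (∀ v, Acc b w v → ∃ v', Acc b w' v' ∧ Sim Q n {c | c ≠ b} v v') ∧
      (∀ v', Acc b w' v' → ∃ v, Acc b w v ∧ Sim Q n {c | c ≠ b} v v')

theorem Sim.atoms {Q : List P} {n : ℕ} {C : Set A} {w w' : World P A} (h : Sim Q n C w w') :
    ∀ p ∈ Q, atom p ∈ w ↔ atom p ∈ w' := by
  cases n with
  | zero => exact h
  | succ n => exact h.1

theorem Sim.pred {Q : List P} {n : ℕ} : ∀ {C : Set A} {w w' : World P A},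
    Sim Q (n + 1) C w w' → Sim Q n C w w' := by
  induction n with
  | zero => exact fun h => h.1
  | succ n ih =>
    refine fun h => ⟨h.1, fun b hb => ⟨fun v hv => ?_, fun v hv => ?_⟩⟩
    · obtain ⟨v', h₁, h₂⟩ := (h.2 b hb).1 v hv
      exact ⟨v', h₁, ih h₂⟩
    · obtain ⟨v', h₁, h₂⟩ := (h.2 b hb).2 v hv
      exact ⟨v', h₁, ih h₂⟩

/-- Successors of similar worlds that are similar for the other agents are similar for all. -/
theorem Sim.succ_univ {Q : List P} {n : ℕ} {a : A} {w w' v v' : World P A}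
    (h : Sim Q (n + 1) Set.univ w w') (hv : Acc a w v) (hv' : Acc a w' v')
    (hs : Sim Q n {c | c ≠ a} v v') : Sim Q n Set.univ v v' := by
  cases n with
  | zero => exact hs
  | succ n =>
    refine ⟨hs.1, fun b _ => ?_⟩
    by_cases hba : b = a
    -- A `b`-successor of `v` is one of `w` by transitivity, and its match below `w'` is a
    -- `b`-successor of `v'` by Euclideanness. The extra level of depth in `h` pays for this detour.
    · subst hba
      refine ⟨fun x hx => ?_, fun x hx => ?_⟩
      · obtain ⟨x', h₁, h₂⟩ := (h.2 b trivial).1 x (hv.trans hx)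
        exact ⟨x', hv'.eucl h₁, h₂.pred⟩
      · obtain ⟨x', h₁, h₂⟩ := (h.2 b trivial).2 x (hv'.trans hx)
        exact ⟨x', hv.eucl h₁, h₂.pred⟩
    · exact hs.2 b hba

/-- Similarity preserves modal formulas of bounded depth over the given atoms. -/
theorem exists_sim_invariant (φ : Form P A) (hφ : φ.IsModal) : ∃ (Q : List P) (n : ℕ),
    ∀ (Q' : List P) (m : ℕ), Q ⊆ Q' → n ≤ m → ∀ w w' : World P A,
      Sim Q' m Set.univ w w' → (φ ∈ w ↔ φ ∈ w') := by
  induction φ using Form.rec (motive_2 := fun _ => True) with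
  | atom p => exact ⟨[p], 0, fun Q' m hQ _ w w' h => h.atoms p (hQ (by simp))⟩
  | neg φ ih =>
    obtain ⟨Q, n, h⟩ := ih hφ
    exact ⟨Q, n, fun Q' m hQ hm w w' hs => by simp [h Q' m hQ hm w w' hs]⟩
  | and φ ψ ih₁ ih₂ =>
    obtain ⟨Q₁, n₁, h₁⟩ := ih₁ hφ.1
    obtain ⟨Q₂, n₂, h₂⟩ := ih₂ hφ.2
    refine ⟨Q₁ ++ Q₂, max n₁ n₂, fun Q' m hQ hm w w' hs => ?_⟩
    rw [List.append_subset] at hQ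
    simp [h₁ Q' m hQ.1 (by omega) w w' hs, h₂ Q' m hQ.2 (by omega) w w' hs]
  | box a φ ih =>
    obtain ⟨Q, n, h⟩ := ih hφ
    refine ⟨Q, n + 1, fun Q' m hQ hm w w' hs => ?_⟩
    obtain ⟨m, rfl⟩ : ∃ k, m = k + 1 := ⟨m - 1, by omega⟩
    simp only [mem_box]
    refine ⟨fun hw v' hv' => ?_, fun hw v hv => ?_⟩
    · obtain ⟨v, hv, hvv⟩ := (hs.2 a trivial).2 v' hv'
      exact (h Q' m hQ (by omega) v v' (hs.succ_univ hv hv' hvv)).1 (hw v hv)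
    · obtain ⟨v', hv', hvv⟩ := (hs.2 a trivial).1 v hv
      exact (h Q' m hQ (by omega) v v' (hs.succ_univ hv hv' hvv)).2 (hw v' hv')
  | allActs α φ => exact hφ.elim
  | allRefs φ => exact hφ.elim
  | _ => trivial

open Classical in
/-- The literals over `Q` that hold at a world. -/
noncomputable def diagram (Q : List P) (w : World P A) : Form P A :=
  bigAnd (Q.map fun p => if p ∈ Q.filter (fun p => atom p ∈ w) then atom p else neg (atom p))

theorem mem_diagram {Q : List P} {u w : World P A} :
    diagram Q u ∈ w ↔ ∀ p ∈ Q, atom p ∈ u ↔ atom p ∈ w := by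
  simp only [diagram, mem_bigAnd, List.mem_map, forall_exists_index, and_imp,
    forall_apply_eq_imp_iff₂]
  refine forall₂_congr fun p hp => ?_
  by_cases h : atom p ∈ u <;> simp [h, hp]

theorem isProp_diagram (Q : List P) (w : World P A) : (diagram Q w).IsProp := by
  refine closed_bigAnd (p := IsProp) (fun _ h => h) (fun _ _ h h' => ⟨h, h'⟩) isProp_bot ?_
  simp only [List.mem_map, forall_exists_index, and_imp, forall_apply_eq_imp_iff₂]
  intro p _
  split_ifs <;> trivial

theorem finite_range_filter {α : Type*} {ι : Type*} (l : List α) (p : ι → α → Bool) :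
    (Set.range fun i => l.filter (p i)).Finite := by
  refine (List.finite_toSet l.sublists).subset ?_
  rintro _ ⟨i, rfl⟩
  simp [List.filter_sublist]

/-- A diagram depends on its world only through a sublist of `Q`. -/
theorem finite_range_diagram (Q : List P) : (Set.range (diagram Q (A := A))).Finite := by
  classical
  refine ((finite_range_filter Q fun (w : World P A) p => decide (atom p ∈ w)).image
    fun l => bigAnd (Q.map fun p => if p ∈ l then atom p else neg (atom p))).subset ?_
  rintro _ ⟨w, rfl⟩
  exact ⟨_, ⟨w, rfl⟩, rfl⟩

/-- Every world satisfies one of finitely many terms that determine it up to similarity. -/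
theorem exists_types (Q : List P) (n : ℕ) : ∀ C : Finset A, ∃ τ : World P A → Form P A,
    (Set.range τ).Finite ∧ (∀ w, IsTerm C (τ w)) ∧ (∀ w, τ w ∈ w) ∧
    ∀ u w w', τ u ∈ w → τ u ∈ w' → Sim Q n C w w' := by
  classical
  induction n with
  | zero =>
    refine fun C => ⟨fun w => Form.and (diagram Q w) top, ?_, fun w => ?_, fun w => ?_, ?_⟩
    · refine ((finite_range_diagram Q).image fun φ => Form.and φ top).subset ?_
      rintro _ ⟨w, rfl⟩
      exact ⟨_, ⟨w, rfl⟩, rfl⟩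
    · exact ⟨_, isProp_diagram Q w, ∅, by simp, fun _ => [], by simp, by simp [bigAnd]⟩
    · simp [mem_diagram]
    · intro u w w' h h' p hp
      simp only [mem_and, mem_diagram] at h h'
      exact (h.1 p hp).symm.trans (h'.1 p hp)
  | succ n ih =>
    intro C
    choose τ hfin hterm hmem hsim using fun b : A => ih (Finset.univ.erase b)
    let T : A → List (Form P A) := fun b => (hfin b).toFinset.toList
    have hT : ∀ b φ, φ ∈ T b ↔ ∃ w, τ b w = φ := by simp [T]
    -- The types of depth `n`, alternating away from `b`, that are realised at some `b`-successor of
    -- `w`.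
    let Γ : World P A → A → List (Form P A) := fun w b =>
      (T b).filter fun t => ∃ v, Acc b w v ∧ t ∈ v
    have hΓ : ∀ w b φ, φ ∈ Γ w b ↔ (∃ u, τ b u = φ) ∧ ∃ v, Acc b w v ∧ φ ∈ v := by
      simp [Γ, hT]
    refine ⟨fun w => Form.and (diagram Q w) (bigAnd (C.toList.map fun b => cover b (Γ w b))),
      ?_, fun w => ?_, fun w => ?_, ?_⟩
    · have hG : {G : A → List (Form P A) | ∀ b, G b ∈ Set.range fun w => Γ w b}.Finite :=
        Set.Finite.pi' fun b => finite_range_filter (T b) fun w t => decide (∃ v, Acc b w v ∧ t ∈ v)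
      refine (Set.Finite.image2 (fun φ G => Form.and φ (bigAnd (C.toList.map fun b => cover b (G b))))
        (finite_range_diagram Q) hG).subset ?_
      rintro _ ⟨w, rfl⟩
      exact ⟨_, ⟨w, rfl⟩, Γ w, fun b => ⟨w, rfl⟩, rfl⟩
    · refine ⟨_, isProp_diagram Q w, C, subset_rfl, Γ w, fun b _ γ hγ => ?_, rfl⟩
      obtain ⟨⟨u, rfl⟩, -⟩ := (hΓ _ _ _).1 hγ
      exact (hterm b u).isADNF (by simp)
    · simp only [mem_and, mem_diagram, mem_bigAnd, List.mem_map, forall_exists_index, and_imp,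
        forall_apply_eq_imp_iff₂, mem_cover]
      refine ⟨by simp, fun b _ => ⟨fun v hv => ?_, fun γ hγ => ((hΓ _ _ _).1 hγ).2⟩⟩
      exact ⟨τ b v, (hΓ _ _ _).2 ⟨⟨v, rfl⟩, v, hv, hmem b v⟩, hmem b v⟩
    -- If two worlds satisfy the same cover, each successor of one shares a type with a successor of
    -- the other, which is one direction of the back-and-forth condition.
    · have half : ∀ u w w' b, cover b (Γ u b) ∈ w → cover b (Γ u b) ∈ w' →
          ∀ v, Acc b w v → ∃ v', Acc b w' v' ∧ ∃ x, τ b x ∈ v ∧ τ b x ∈ v' := by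
        intro u w w' b h h' v hv
        rw [mem_cover] at h h'
        obtain ⟨γ, hγ, hγv⟩ := h.1 v hv
        obtain ⟨v', hv', hγv'⟩ := h'.2 γ hγ
        obtain ⟨⟨x, rfl⟩, -⟩ := (hΓ _ _ _).1 hγ
        exact ⟨v', hv', x, hγv, hγv'⟩
      have hset : ∀ b : A, ((Finset.univ.erase b : Finset A) : Set A) = {c | c ≠ b} := by
        intro b; ext c; simp
      intro u w w' h h'
      simp only [mem_and, mem_diagram, mem_bigAnd, List.mem_map, forall_exists_index, and_imp,
        forall_apply_eq_imp_iff₂, Finset.mem_toList] at h h'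
      refine ⟨fun p hp => (h.1 p hp).symm.trans (h'.1 p hp), fun b hb => ⟨fun v hv => ?_,
        fun v hv => ?_⟩⟩
      · obtain ⟨v', hv', x, hx, hx'⟩ := half u w w' b (h.2 b hb) (h'.2 b hb) v hv
        exact ⟨v', hv', hset b ▸ hsim b x v v' hx hx'⟩
      · obtain ⟨v', hv', x, hx, hx'⟩ := half u w' w b (h'.2 b hb) (h.2 b hb) v hv
        exact ⟨v', hv', hset b ▸ hsim b x v' v hx' hx⟩

/-- Disjunctive normal forms exist. -/
theorem exists_normal_form {φ : Form P A} (hφ : φ.IsModal) :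
    ∃ l : List (Form P A), (∀ t ∈ l, IsTerm Finset.univ t) ∧ Equi φ (bigOr l) := by
  classical
  obtain ⟨Q, n, hinv⟩ := exists_sim_invariant φ hφ
  obtain ⟨τ, hfin, hterm, hmem, hsim⟩ := exists_types (A := A) Q n Finset.univ
  -- The disjuncts are the types compatible with `φ`; by invariance, `φ` holds wherever such a type
  -- does.
  refine ⟨hfin.toFinset.toList.filter fun t => ∃ w : World P A, t ∈ w ∧ φ ∈ w, ?_, fun w => ?_⟩
  · simp only [List.mem_filter, Finset.mem_toList, Set.Finite.mem_toFinset, Set.mem_range]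
    rintro _ ⟨⟨w, rfl⟩, -⟩
    exact hterm w
  · simp only [mem_bigOr, List.mem_filter, Finset.mem_toList, Set.Finite.mem_toFinset,
      Set.mem_range, decide_eq_true_eq]
    refine ⟨fun h => ⟨τ w, ⟨⟨w, rfl⟩, w, hmem w, h⟩, hmem w⟩, ?_⟩
    rintro ⟨_, ⟨⟨u, rfl⟩, w', hw', hφ'⟩, hw⟩
    have := hsim u w' w hw' hw
    rw [Finset.coe_univ] at this
    exact (hinv Q n (List.Subset.refl _) le_rfl w' w this).1 hφ'

/-! Elimination of action formulae. -/

/-- Formulas that are provably equivalent to a modal formula. -/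
def Reducible (φ : Form P A) : Prop := ∃ μ : Form P A, μ.IsModal ∧ Equi φ μ

theorem Reducible.congr {φ ψ : Form P A} (h : Equi φ ψ) (hψ : Reducible ψ) : Reducible φ :=
  let ⟨μ, hμ, h'⟩ := hψ
  ⟨μ, hμ, h.trans h'⟩

theorem Reducible.neg {φ : Form P A} (h : Reducible φ) : Reducible (neg φ) :=
  let ⟨μ, hμ, h⟩ := h
  ⟨.neg μ, hμ, h.neg⟩

theorem Reducible.and {φ ψ : Form P A} (h : Reducible φ) (h' : Reducible ψ) :
    Reducible (Form.and φ ψ) :=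
  let ⟨μ, hμ, h⟩ := h
  let ⟨μ', hμ', h'⟩ := h'
  ⟨.and μ μ', ⟨hμ, hμ'⟩, h.and h'⟩

theorem Reducible.box {φ : Form P A} (a : A) (h : Reducible φ) : Reducible (box a φ) :=
  let ⟨μ, hμ, h⟩ := h
  ⟨.box a μ, hμ, h.box a⟩

/-- LP, LN and LC push the learning operator down to the outermost boxes. There LK1 passes to `α`
and `β`, provided the boxed formula is restricted, which is what `AltOuter` ensures. -/
theorem reducible_learn {B : Finset A} {hB : B.Nonempty} {α β : Act P A}
    (hα : ∀ ψ : Form P A, ψ.IsModal → Reducible (allActs α ψ))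
    (hβ : ∀ ψ : Form P A, ψ.IsModal → Reducible (allActs β ψ)) :
    ∀ {ψ : Form P A}, AltOuter ψ → Reducible (allActs (.learn B hB α β) ψ)
  | .atom p, _ => ⟨atom p, trivial, .of_provable (.LP ..)⟩
  | .neg ψ, h => .congr (.of_provable (.LN ..)) (reducible_learn (ψ := ψ) hα hβ h).neg
  | .and _ _, h => .congr (.of_provable (.LC ..))
      ((reducible_learn hα hβ h.1).and (reducible_learn hα hβ h.2))
  | .box a χ, h => by
    by_cases ha : a ∈ B
    · have hχ : χ.IsModal := isModal_of_isRestricted h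
      exact .congr (.of_provable (.LK1 _ _ _ _ a ha χ h))
        (.box a (.congr (.of_provable (.LU ..)) ((hα χ hχ).and (hβ χ hχ))))
    · exact ⟨box a χ, isModal_of_isRestricted (φ := χ) h, .of_provable (.LK2 _ _ _ _ a ha χ)⟩

mutual

/-- Elimination is innermost first: normality allows the argument of `[α]` to be replaced by a modal
equivalent, to which LT applies directly and the learning axioms after passage to normal form. -/
theorem reducible_of_isAFL : ∀ φ : Form P A, φ.IsAFL → Reducible φ
  | .atom p, _ => ⟨atom p, trivial, fun _ => Iff.rfl⟩
  | .neg φ, h => (reducible_of_isAFL φ (by simpa only [Form.IsAFL] using h)).neg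
  | .and φ ψ, h => by
    simp only [Form.IsAFL] at h
    exact (reducible_of_isAFL φ h.1).and (reducible_of_isAFL ψ h.2)
  | .box a φ, h => (reducible_of_isAFL φ (by simpa only [Form.IsAFL] using h)).box a
  | .allActs α φ, h => by
    simp only [Form.IsAFL] at h
    obtain ⟨μ, hμ, hφ⟩ := reducible_of_isAFL φ h.2
    exact .congr (hφ.allActs α) (reducible_allActs α h.1 μ hμ)
  | .allRefs φ, h => by simp [Form.IsAFL] at h

theorem reducible_allActs : ∀ α : Act P A, α.IsAFL → ∀ ψ : Form P A, ψ.IsModal →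
    Reducible (allActs α ψ)
  | .test φ, h, ψ, hψ => .congr (.of_provable (.LT φ ψ hψ))
      ((reducible_of_isAFL φ (by simpa only [Act.IsAFL] using h)).and
        (Reducible.neg ⟨ψ, hψ, fun _ => Iff.rfl⟩)).neg
  | .choice α β, h, ψ, hψ => by
    simp only [Act.IsAFL] at h
    exact .congr (.of_provable (.LU ..))
      ((reducible_allActs α h.1 ψ hψ).and (reducible_allActs β h.2 ψ hψ))
  | .seq α β, h, ψ, hψ => by
    simp only [Act.IsAFL] at h
    obtain ⟨μ, hμ, hψμ⟩ := reducible_allActs β h.2 ψ hψ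
    exact .congr ((Equi.of_provable (.LS ..)).trans (hψμ.allActs α))
      (reducible_allActs α h.1 μ hμ)
  | .learn B hB α β, h, ψ, hψ => by
    simp only [Act.IsAFL] at h
    obtain ⟨l, hl, hψl⟩ := exists_normal_form hψ
    exact .congr (hψl.allActs _) (reducible_learn (reducible_allActs α h.1)
      (reducible_allActs β h.2) (altOuter_bigOr fun t ht => (hl t ht).altOuter))

end

/-- LT covers modal `ψ` only; reduction extends it to postconditions that contain further actions,
as needed for a test followed by learning. -/
theorem equi_test {φ ψ : Form P A} (hψ : ψ.IsAFL) :
    Equi (allActs (.test φ) ψ) (imp φ ψ) := by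
  obtain ⟨μ, hμ, h⟩ := reducible_of_isAFL ψ hψ
  intro w
  rw [h.allActs (.test φ) w, Equi.of_provable (.LT φ μ hμ) w, mem_imp, mem_imp, h w]

/-! Synthesis. -/

/-- There is an action formula that realises `φ` whenever some refinement does. -/
def Synthesizable (φ : Form P A) : Prop :=
  ∃ α : Act P A, α.IsAFL ∧ Provable (allActs α φ) ∧
    Provable (imp (someRefs φ) (someActs α φ))

theorem Synthesizable.congr {φ ψ : Form P A} (h : Equi φ ψ) (hψ : Synthesizable ψ) :
    Synthesizable φ := by
  obtain ⟨α, hα, h₁, h₂⟩ := hψ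
  refine ⟨α, hα, ?_, ?_⟩ <;> simp only [provable_iff] at *
  · exact fun w => (h.allActs α w).2 (h₁ w)
  · intro w
    have := h₂ w
    simp only [mem_imp, mem_someRefs, someActs, mem_neg, h.neg.allActs α w, h _] at this ⊢
    exact this

/-- The choice between the action formulae for the members of a list. -/
theorem exists_choice {l : List (Form P A)} (h : ∀ γ ∈ l, Synthesizable γ) :
    ∃ β : Act P A, β.IsAFL ∧ Provable (allActs β (bigOr l)) ∧
      ∀ γ ∈ l, Provable (imp (someRefs γ) (someActs β γ)) := by
  induction l with
  | nil =>
    -- The empty choice is the action that can never be executed, so that `[?⊥] ⊥` holds.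
    refine ⟨.test bot, ?_, ?_, by simp⟩
    · simp only [Act.IsAFL]
      exact isAFL_of_isModal (isModal_of_isProp isProp_bot)
    · rw [provable_iff]
      intro w
      rw [equi_test (isAFL_of_isModal (isModal_bigOr (by simp))) w]
      simp
  | cons γ l ih =>
    obtain ⟨β, hβ, h₁, h₂⟩ := ih fun γ hγ => h γ (by simp [hγ])
    obtain ⟨α, hα, h₃, h₄⟩ := h γ (by simp)
    have hU := fun φ => Equi.of_provable (Provable.LU α β φ)
    refine ⟨.choice α β, by simp only [Act.IsAFL]; exact ⟨hα, hβ⟩, ?_, ?_⟩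
    · rw [provable_iff] at *
      intro w
      rw [hU, mem_and, mem_allActs, mem_allActs]
      refine ⟨fun v hv => ?_, fun v hv => ?_⟩
      · exact mem_or.2 (.inl (mem_allActs.1 (h₃ w) v hv))
      · exact mem_or.2 (.inr (mem_allActs.1 (h₁ w) v hv))
    · intro δ hδ
      rw [provable_iff]
      intro w
      rw [mem_imp, someActs, mem_neg, hU, mem_and]
      intro hw hn
      rcases List.mem_cons.1 hδ with rfl | hδ
      · exact mem_neg.1 (mem_imp.1 (w.provable_mem h₄) hw) hn.1
      · exact mem_neg.1 (mem_imp.1 (w.provable_mem (h₂ δ hδ)) hw) hn.2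

/-- A refinement satisfying the disjunction satisfies some `γ` in it, and `⟨β⟩ γ` implies `⟨β⟩` of
the disjunction. -/
theorem Synthesizable.bigOr {l : List (Form P A)} (h : ∀ γ ∈ l, Synthesizable γ) :
    Synthesizable (bigOr l) := by
  obtain ⟨β, hβ, h₁, h₂⟩ := exists_choice h
  refine ⟨β, hβ, h₁, provable_iff.2 fun w => mem_imp.2 fun hw => mem_neg.2 fun hn => ?_⟩
  obtain ⟨v, hv, hφ⟩ := mem_someRefs.1 hw
  obtain ⟨γ, hγ, hγv⟩ := mem_bigOr.1 hφ
  refine mem_neg.1 (mem_imp.1 (w.provable_mem (h₂ γ hγ)) (mem_someRefs.2 ⟨v, hv, hγv⟩)) ?_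
  rw [mem_allActs] at hn ⊢
  intro x hx
  rw [mem_neg]
  exact fun hγx => mem_neg.1 (hn x hx) (mem_bigOr.2 ⟨γ, hγ, hγx⟩)

-- Learning, and the synthesis of actions for terms.

/-- The world reached by a learning action. -/
def learnWorld (B : Finset A) (hB : B.Nonempty) (α β : Act P A) (w : World P A) : World P A where
  carrier := {φ | allActs (.learn B hB α β) φ ∈ w}
  neg_mem' φ := (Equi.of_provable (.LN B hB α β φ) w).trans mem_neg
  and_mem' φ ψ := (Equi.of_provable (.LC B hB α β φ ψ) w).trans mem_and
  provable_mem' _ h := w.provable_mem (.necL _ _ h)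

/-- Learning by several agents, each by its own action formula. -/
theorem exists_learn (β : A → Act P A) (B : Finset A) (hβ : ∀ b ∈ B, (β b).IsAFL) :
    ∃ l : Act P A, l.IsAFL ∧ ∀ w : World P A, ∃ w' : World P A,
      (∀ φ : Form P A, φ.IsAFL → (allActs l φ ∈ w ↔ φ ∈ w')) ∧
      (∀ p, atom p ∈ w' ↔ atom p ∈ w) ∧
      (∀ b ∈ B, ∀ χ : Form P A, χ.IsRestricted {c | c ≠ b} →
        (box b χ ∈ w' ↔ box b (allActs (β b) χ) ∈ w)) ∧
      (∀ b ∉ B, ∀ φ, box b φ ∈ w' ↔ box b φ ∈ w) := by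
  classical
  induction B using Finset.induction_on with
  | empty =>
    -- With nobody learning, the action is the trivial test; `equi_test` is the reason why `φ` is
    -- required to be free of `∀R`.
    refine ⟨.test top, ?_, fun w => ⟨w, fun φ hφ => ?_, ?_⟩⟩
    · simp only [Act.IsAFL]
      exact isAFL_of_isModal (isModal_of_isProp isProp_bot (A := A))
    · rw [equi_test hφ w]; simp
    · simp
  | insert b B hb ih =>
    obtain ⟨l, hl, h⟩ := ih fun c hc => hβ c (by simp [hc])
    have hβb := hβ b (by simp)
    -- Both arguments are `β b`, so that LK1 and LU yield just `[β b]`. By LK2 the learning of one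
    -- agent leaves all boxes of the others unchanged, whatever stands inside them, so the agents
    -- can learn one after another.
    let L : Act P A := .learn {b} (by simp) (β b) (β b)
    refine ⟨.seq L l, by simp only [L, Act.IsAFL]; exact ⟨⟨hβb, hβb⟩, hl⟩, fun w => ?_⟩
    let w₁ := learnWorld {b} (by simp) (β b) (β b) w
    have hw₁ : ∀ φ, φ ∈ w₁ ↔ allActs L φ ∈ w := fun _ => Iff.rfl
    obtain ⟨w', h₁, h₂, h₃, h₄⟩ := h w₁
    refine ⟨w', fun φ hφ => ?_, fun p => ?_, fun c hc χ hχ => ?_, fun c hc φ => ?_⟩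
    · rw [Equi.of_provable (.LS L l φ) w, ← hw₁, h₁ φ hφ]
    · rw [h₂, hw₁, Equi.of_provable (.LP ..) w]
    · by_cases hcb : c = b
      · subst hcb
        rw [h₄ c hb, hw₁, Equi.of_provable (.LK1 _ _ _ _ c (by simp) χ hχ) w,
          Equi.box c (Equi.of_provable (.LU ..)) w]
        simp only [mem_box, mem_and, and_self]
      · have hcB : c ∈ B := by simpa [hcb] using hc
        rw [h₃ c hcB χ hχ, hw₁, Equi.of_provable (.LK2 _ _ _ _ c (by simpa using hcb) _) w]
    · simp only [Finset.mem_insert, not_or] at hc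
      rw [h₄ c hc.2, hw₁, Equi.of_provable (.LK2 _ _ _ _ c (by simpa using hc.1) _) w]

theorem mem_iff_of_isProp {w w' : World P A} (h : ∀ p, atom p ∈ w' ↔ atom p ∈ w) :
    ∀ {π : Form P A}, π.IsProp → (π ∈ w' ↔ π ∈ w)
  | .atom p, _ => h p
  | .neg π, hπ => by rw [mem_neg, mem_neg, mem_iff_of_isProp h (π := π) hπ]
  | .and _ _, hπ => by
    rw [mem_and, mem_and, mem_iff_of_isProp h hπ.1, mem_iff_of_isProp h hπ.2]

/-- Each `Γ b` is handled by a single choice action `β b`: every outcome of it satisfies some `γ ∈ Γ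
b`, and it can achieve each `γ` that a refinement can. -/
theorem synthesizable_term {π : Form P A} (hπ : π.IsProp) {B : Finset A}
    {Γ : A → List (Form P A)} (hΓ : ∀ b ∈ B, ∀ γ ∈ Γ b, IsADNF b γ)
    (hs : ∀ b ∈ B, ∀ γ ∈ Γ b, Synthesizable γ) :
    Synthesizable (Form.and π (bigAnd (B.toList.map fun b => cover b (Γ b)))) := by
  have hex : ∀ b : A, ∃ β : Act P A, b ∈ B → β.IsAFL ∧ Provable (allActs β (bigOr (Γ b))) ∧
      ∀ γ ∈ Γ b, Provable (imp (someRefs γ) (someActs β γ)) := by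
    intro b
    by_cases hb : b ∈ B
    · obtain ⟨β, h⟩ := exists_choice (hs b hb)
      exact ⟨β, fun _ => h⟩
    · exact ⟨.test bot, fun h => absurd h hb⟩
  choose β hβ using hex
  obtain ⟨l, hl, hlearn⟩ := exists_learn β B fun b hb => (hβ b hb).1
  set t := Form.and π (bigAnd (B.toList.map fun b => cover b (Γ b))) with ht
  have htAFL : t.IsAFL :=
    isAFL_of_isModal (IsTerm.altOuter ⟨π, hπ, B, B.subset_univ, Γ, hΓ, rfl⟩).isModal
  have htneg : (neg t).IsAFL := by simpa only [Form.IsAFL] using htAFL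
  -- The precondition: the right-hand side of RK45 with `⟨β b⟩` in place of `∃R`, so that it can be
  -- used as a test.
  let e : Form P A := Form.and π (bigAnd (B.toList.map fun b =>
    bigAnd ((Γ b).map fun γ => diamond b (someActs (β b) γ))))
  have he : ∀ w : World P A, e ∈ w ↔ π ∈ w ∧ ∀ b ∈ B, ∀ γ ∈ Γ b,
      diamond b (someActs (β b) γ) ∈ w := by
    intro w
    simp only [e, mem_and, mem_bigAnd, List.mem_map, forall_exists_index, and_imp,
      forall_apply_eq_imp_iff₂, Finset.mem_toList]
  have heAFL : e.IsAFL := by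
    have hn : ∀ φ : Form P A, φ.IsAFL → (neg φ).IsAFL := fun φ h => by
      simpa only [Form.IsAFL] using h
    have ha : ∀ φ ψ : Form P A, φ.IsAFL → ψ.IsAFL → (Form.and φ ψ).IsAFL := fun φ ψ h h' => by
      simpa only [Form.IsAFL] using ⟨h, h'⟩
    have hb : (bot : Form P A).IsAFL := isAFL_of_isModal (isModal_of_isProp isProp_bot)
    refine ha _ _ (isAFL_of_isModal (isModal_of_isProp hπ)) (closed_bigAnd hn ha hb ?_)
    simp only [List.mem_map, Finset.mem_toList, forall_exists_index, and_imp,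
      forall_apply_eq_imp_iff₂]
    refine fun b hbB => closed_bigAnd hn ha hb ?_
    simp only [List.mem_map, forall_exists_index, and_imp, forall_apply_eq_imp_iff₂]
    intro γ hγ
    simp only [diamond, someActs, Form.IsAFL]
    exact ⟨(hβ b hbB).1,
      isAFL_of_isModal (isModal_of_isRestricted (hΓ b hbB γ hγ).isRestricted)⟩
  -- In a cover, the box part becomes `□_b [β b] ⋁ Γ b`, a theorem by necessitation, and the diamond
  -- part becomes `◇_b ⟨β b⟩ γ`, a conjunct of `e`.
  have key : ∀ w w' : World P A, (∀ p, atom p ∈ w' ↔ atom p ∈ w) →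
      (∀ b ∈ B, ∀ χ : Form P A, χ.IsRestricted {c | c ≠ b} →
        (box b χ ∈ w' ↔ box b (allActs (β b) χ) ∈ w)) → e ∈ w → t ∈ w' := by
    intro w w' hat hbox hew
    rw [he] at hew
    simp only [ht, mem_and, mem_bigAnd, List.mem_map, forall_exists_index, and_imp,
      forall_apply_eq_imp_iff₂, Finset.mem_toList]
    refine ⟨(mem_iff_of_isProp hat hπ).2 hew.1, fun b hb => ?_⟩
    have hr : ∀ γ ∈ Γ b, γ.IsRestricted {c | c ≠ b} := fun γ hγ => (hΓ b hb γ hγ).isRestricted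
    rw [cover, mem_and, mem_bigAnd, hbox b hb _ (isRestricted_bigOr hr)]
    refine ⟨w.provable_mem (.necK _ _ (hβ b hb).2.1), ?_⟩
    simp only [List.mem_map, forall_exists_index, and_imp, forall_apply_eq_imp_iff₂]
    intro γ hγ
    obtain ⟨v, hv, hγv⟩ := mem_diamond.1 (hew.2 b hb γ hγ)
    rw [diamond, mem_neg, hbox b hb (neg γ) (hr γ hγ), mem_box]
    exact fun h => mem_neg.1 hγv (h v hv)
  refine ⟨.seq (.test e) l, by simp only [Act.IsAFL]; exact ⟨heAFL, hl⟩, ?_, ?_⟩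
  · rw [provable_iff]
    intro w
    obtain ⟨w', h₁, h₂, h₃, -⟩ := hlearn w
    rw [Equi.of_provable (.LS ..) w, equi_test (by simp only [Form.IsAFL]; exact ⟨hl, htAFL⟩) w,
      mem_imp, h₁ t htAFL]
    exact key w w' h₂ h₃
  · rw [provable_iff]
    intro w
    obtain ⟨w', h₁, h₂, h₃, -⟩ := hlearn w
    rw [mem_imp, someActs, mem_neg, Equi.of_provable (.LS ..) w,
      equi_test (by simp only [Form.IsAFL]; exact ⟨hl, htAFL⟩) w, mem_imp, h₁ (neg t) htneg,
      mem_neg, mem_someRefs]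
    rintro ⟨v, hv, htv⟩ hn
    simp only [ht, mem_and, mem_bigAnd, List.mem_map, forall_exists_index, and_imp,
      forall_apply_eq_imp_iff₂, Finset.mem_toList] at htv
    have hew : e ∈ w := by
      refine (he w).2 ⟨?_, fun b hb γ hγ => ?_⟩
      · by_contra hπw
        -- If `π` failed at `w`, RP would carry `¬π` to the refinement `v`.
        have := (Equi.of_provable (.RP (neg π) hπ) w).2 (mem_neg.2 hπw)
        exact mem_neg.1 (hv _ this) htv.1
      -- The refinement `v` satisfies each cover separately, so RK45 applies to one agent at a time.
      · have := (Equi.of_provable (.RK45 b (Γ b) (hΓ b hb)) w).1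
          (mem_someRefs.2 ⟨v, hv, htv.2 b hb⟩)
        simp only [mem_bigAnd, List.mem_map, forall_exists_index, and_imp,
          forall_apply_eq_imp_iff₂] at this
        obtain ⟨x, hx, hγx⟩ := mem_diamond.1 (this γ hγ)
        exact mem_diamond.2 ⟨x, hx, mem_imp.1 (x.provable_mem ((hβ b hb).2.2 γ hγ)) hγx⟩
    exact hn hew (key w w' h₂ h₃ hew)

theorem Form.IsADNF.synthesizable {a : A} {φ : Form P A} (h : IsADNF a φ) : Synthesizable φ := by
  induction h with
  | conj a π hπ B haB Γ hΓ ih => exact synthesizable_term hπ hΓ ih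
  | disj a φ ψ _ _ h₁ h₂ =>
    refine Synthesizable.congr (ψ := Form.bigOr [φ, ψ]) (fun w => by simp) (.bigOr ?_)
    simpa using ⟨h₁, h₂⟩

theorem synthesizable_of_isAFL {φ : Form P A} (hφ : φ.IsAFL) : Synthesizable φ := by
  obtain ⟨μ, hμ, hφμ⟩ := reducible_of_isAFL φ hφ
  obtain ⟨l, hl, hμl⟩ := exists_normal_form hμ
  refine .congr (hφμ.trans hμl) (.bigOr fun t ht => ?_)
  obtain ⟨π, hπ, B, -, Γ, hΓ, rfl⟩ := hl t ht
  exact synthesizable_term hπ hΓ fun b hb γ hγ => Form.IsADNF.synthesizable (hΓ b hb γ hγ)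

end ActionFormulaLogic

theorem mainTheorem5 {P : Type*} {A : Type*} [Nonempty P] [Countable P] [Fintype A] [Nonempty A]
    (φ : ActionFormulaLogic.Form P A) (hφ : φ.IsAFL) :
    ∃ α : ActionFormulaLogic.Act P A, α.IsAFL ∧
      ActionFormulaLogic.Provable (.allActs α φ) ∧
      ActionFormulaLogic.Provable (.imp (.someRefs φ) (.someActs α φ)) :=
  ActionFormulaLogic.synthesizable_of_isAFL hφ
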